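/- Let $r\in\{\infty,\omega\}$ ($C^\omega$ means real analytic), and let $C\subset\mathbb R^3$ be the image of a closed $C^r$-embedded curve $\gamma:\mathbb R/l\mathbb Z\to\mathbb R^3$ ($l>0$) with positive curvature. A $C^r$-cuspidal edge along $C$ is a $C^r$-map $f:(\mathbb R/a\mathbb Z)\times(-\varepsilon,\varepsilon)\to\mathbb R^3$, for some $a,\varepsilon>0$, such that $t\mapsto f(t,0)$ is a bijection of $\mathbb R/a\mathbb Z$ onto $C$ and every point $(t,0)$ is a cuspidal edge of $f$, that is, there are a $C^r$-diffeomorphism $\phi$ from a neighbourhood $V$ of the point to a neighbourhood of the origin of $\mathbb R^2$ and a $C^r$-diffeomorphism $\Phi$ from an open set containing $f(V)$ to a neighbourhood of the origin of $\mathbb R^3$, taking the point and its image under $f$ to the origins, with $\Phi\circ f\circ\phi^{-1}(u,v)=(u^2,u^3,v)$. Let $f$ and $g$ be map germs represented by $C^r$-cuspidal edges along $C$, defined near $K_f=(\mathbb R/a\mathbb Z)\times\{0\}$ and $K_g=(\mathbb R/b\mathbb Z)\times\{0\}$ respectively. For such germs, and more generally for germs of maps into $\mathbb R^3$ along circles $K_f$,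 $K_g$ of this kind: - $g$ is right equivalent to $f$ if there is a $C^r$-diffeomorphism $\phi$ from an open neighbourhood of $K_f$ to an open neighbourhood of $K_g$, inside the domains of the two maps, such that $\phi(K_f)=K_g$ and $f=g\circ\phi$; - $g$ has the same image as $f$ if there are arbitrarily small open neighbourhoods $U_1$ of $K_g$ and $U_2$ of $K_f$ with $g(U_1)=f(U_2)$ (that is, such a pair exists inside any prescribed pair of neighbourhoods); - $g$ is congruent to $f$ if $T\circ g$ has the same image as $f$ for some isometry $T$ of $\mathbb R^3$. Then $g$ is right equivalent to $f$ if and only if $g$ has the same image as $f$. Consequently, if $g$ is congruent to $f$, then there is an isometry $T$ of $\mathbb R^3$ such that $T\circ g$ is right equivalent to $f$. -/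

import Mathlib

open Set Topology Filter
open scoped ContDiff

namespace CuspEdge

/-- Euclidean 3-space. -/
abbrev E3 : Type := EuclideanSpace ℝ (Fin 3)

/-- The covering map `ℝ × ℝ → (ℝ/aℤ) × ℝ`. -/
def cover (a : ℝ) (x : ℝ × ℝ) : AddCircle a × ℝ := ((x.1 : AddCircle a), x.2)

/-- The core circle `(ℝ/aℤ) × {0}`. -/
def core (a : ℝ) : Set (AddCircle a × ℝ) := {p | p.2 = 0}

/-- The curvature `‖(c'/‖c'‖)'‖ / ‖c'‖` of a regular space curve at parameter `t`. -/
noncomputable def curvature (c : ℝ → E3) (t : ℝ) : ℝ :=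
  ‖deriv (fun s => ‖deriv c s‖⁻¹ • deriv c s) t‖ / ‖deriv c t‖

/-- `C` is the image of a closed `C^r`-embedded curve `γ : ℝ/lℤ → ℝ³` with positive curvature.
(As the circle is compact, an injective regular curve is an embedding.) -/
def IsKnot (r : WithTop ℕ∞) (C : Set E3) : Prop :=
  ∃ (l : ℝ) (γ : AddCircle l → E3), 0 < l ∧
    ContDiff ℝ r (fun t : ℝ => γ (t : AddCircle l)) ∧
    Function.Injective γ ∧
    (∀ t, deriv (fun t : ℝ => γ (t : AddCircle l)) t ≠ 0) ∧
    (∀ t, 0 < curvature (fun t : ℝ => γ (t : AddCircle l)) t) ∧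
    C = range γ

/-- The standard cuspidal edge `(u, v) ↦ (u², u³, v)`. -/
noncomputable def standardCuspidalEdge (x : ℝ × ℝ) : E3 := !₂[x.1 ^ 2, x.1 ^ 3, x.2]

/-- `p` is a cuspidal edge of the map `F` with domain `U ⊆ ℝ²`: there are local
`C^r`-diffeomorphisms `φ` from a neighbourhood `V ⊆ U` of `p` to a neighbourhood of `0 ∈ ℝ²`, and
`Φ` from an open set containing `F(V)` to a neighbourhood of `0 ∈ ℝ³`, with `φ(p) = 0`,
`Φ(F(p)) = 0` and `Φ ∘ F ∘ φ⁻¹` the standard cuspidal edge. -/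
def IsCuspidalEdgeAt (r : WithTop ℕ∞) (U : Set (ℝ × ℝ)) (F : ℝ × ℝ → E3) (p : ℝ × ℝ) : Prop :=
  ∃ (φ : OpenPartialHomeomorph (ℝ × ℝ) (ℝ × ℝ)) (Φ : OpenPartialHomeomorph E3 E3),
    ContDiffOn ℝ r φ φ.source ∧ ContDiffOn ℝ r φ.symm φ.target ∧
    ContDiffOn ℝ r Φ Φ.source ∧ ContDiffOn ℝ r Φ.symm Φ.target ∧
    p ∈ φ.source ∧ φ.source ⊆ U ∧ F '' φ.source ⊆ Φ.source ∧
    φ p = 0 ∧ Φ (F p) = 0 ∧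
    ∀ x ∈ φ.target, Φ (F (φ.symm x)) = standardCuspidalEdge x

/-- A map `f : (ℝ/aℤ) × (-ε, ε) → ℝ³` with `a, ε > 0`, representing a map germ along
`(ℝ/aℤ) × {0}`. The values of `toFun` outside the strip are irrelevant. -/
structure StripMap where
  /-- the length `a` of the circle `ℝ/aℤ` -/
  period : ℝ
  period_pos : 0 < period
  /-- the half-width `ε` -/
  eps : ℝ
  eps_pos : 0 < eps
  /-- the map -/
  toFun : AddCircle period × ℝ → E3

namespace StripMap

/-- The strip `(ℝ/aℤ) × (-ε, ε)`. -/
def domain (f : StripMap) : Set (AddCircle f.period × ℝ) := {p | -f.eps < p.2 ∧ p.2 < f.eps}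

/-- The lift of `f` to the universal cover of the strip. -/
def lift (f : StripMap) (x : ℝ × ℝ) : E3 := f.toFun (cover f.period x)

/-- The universal cover `ℝ × (-ε, ε)` of the strip. -/
def liftDomain (f : StripMap) : Set (ℝ × ℝ) := univ ×ˢ Ioo (-f.eps) f.eps

/-- The composition `T ∘ f` with an isometry `T` of `ℝ³`. -/
noncomputable def comp (f : StripMap) (T : E3 ≃ᵢ E3) : StripMap where
  period := f.period
  period_pos := f.period_pos
  eps := f.eps
  eps_pos := f.eps_pos
  toFun := fun p => T (f.toFun p)

/-- `f` is a `C^r`-cuspidal edge along `C`: it is of class `C^r`, `t ↦ f(t, 0)` parametrizes `C`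
once, and every `(t, 0)` is a cuspidal edge. -/
structure IsCuspidalEdgeAlong (r : WithTop ℕ∞) (C : Set E3) (f : StripMap) : Prop where
  contDiffOn : ContDiffOn ℝ r f.lift f.liftDomain
  bijOn : BijOn (fun t : AddCircle f.period => f.toFun (t, 0)) univ C
  cuspidal : ∀ t : ℝ, IsCuspidalEdgeAt r f.liftDomain f.lift (t, 0)

end StripMap

/-- A map `φ` from an open set `W ⊆ (ℝ/aℤ) × ℝ` to `(ℝ/bℤ) × ℝ` is of class `C^r`: near every point
it lifts to a `C^r` map of the universal covers. -/
def ContDiffOnStrip (r : WithTop ℕ∞) {a b : ℝ} (φ : AddCircle a × ℝ → AddCircle b × ℝ)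
    (W : Set (AddCircle a × ℝ)) : Prop :=
  ∀ x : ℝ × ℝ, cover a x ∈ W → ∃ Ψ : ℝ × ℝ → ℝ × ℝ,
    ContDiffAt ℝ r Ψ x ∧ ∀ᶠ y in 𝓝 x, φ (cover a y) = cover b (Ψ y)

/-- `g` is right equivalent to `f`: `f = g ∘ φ` for a `C^r`-diffeomorphism `φ` between open
neighbourhoods of the core circles, inside the domains of `f` and `g`, that maps core circle onto
core circle. -/
def RightEquivalent (r : WithTop ℕ∞) (g f : StripMap) : Prop :=
  ∃ φ : OpenPartialHomeomorph (AddCircle f.period × ℝ) (AddCircle g.period × ℝ),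
    core f.period ⊆ φ.source ∧ φ.source ⊆ f.domain ∧
    core g.period ⊆ φ.target ∧ φ.target ⊆ g.domain ∧
    ContDiffOnStrip r φ φ.source ∧ ContDiffOnStrip r φ.symm φ.target ∧
    φ '' core f.period = core g.period ∧
    ∀ p ∈ φ.source, f.toFun p = g.toFun (φ p)

/-- `g` has the same image as `f`, as a map germ: there are arbitrarily small open neighbourhoods
`U₁`, `U₂` of the core circles with `g(U₁) = f(U₂)`. (Requiring this inside all prescribed
neighbourhoods makes the notion independent of the representatives of the germs.) -/
def SameImage (g f : StripMap) : Prop :=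
  ∀ (V₁ : Set (AddCircle g.period × ℝ)) (V₂ : Set (AddCircle f.period × ℝ)),
    IsOpen V₁ → core g.period ⊆ V₁ → V₁ ⊆ g.domain →
    IsOpen V₂ → core f.period ⊆ V₂ → V₂ ⊆ f.domain →
    ∃ (U₁ : Set (AddCircle g.period × ℝ)) (U₂ : Set (AddCircle f.period × ℝ)),
      IsOpen U₁ ∧ core g.period ⊆ U₁ ∧ U₁ ⊆ V₁ ∧
      IsOpen U₂ ∧ core f.period ⊆ U₂ ∧ U₂ ⊆ V₂ ∧
      g.toFun '' U₁ = f.toFun '' U₂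

/-- `g` is congruent to `f`: `T ∘ g` has the same image as `f`, as a map germ, for some isometry
`T` of `ℝ³`. -/
def Congruent (g f : StripMap) : Prop :=
  ∃ T : E3 ≃ᵢ E3, SameImage (g.comp T) f

end CuspEdge

namespace CuspEdge

/-! A right equivalence carries small neighbourhoods of one core to small neighbourhoods of the
other, so it gives equal images.

Conversely, suppose the images agree. Shrinking neighbourhoods shows that the two core curves have
the same image. Each map is injective on a compact strip around its core (`exists_injOn_strip`), so
`g⁻¹ ∘ f` is a homeomorphism `e` of neighbourhoods preserving the cores. What remains is that `e`
and its inverse are `C^r` near the cores.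

In charts this is a statement about a local diffeomorphism `Ψ` of space with `Ψ(u², u³, v) = (h²,
h³, z)`, where `h = 0` exactly when `u = 0`: the function `h` must be `C^r`
(`exists_contDiffOn_reparametrization`). Write `α = h²`, `β = h³`. The derivative of `Ψ(u², u³, v)`
in `u` is `u • k` with `k = dΨ(2, 3u, 0)`, so differentiating `β² = α³` and cancelling gives `2 k₁ =
3 h k₀`. Injectivity of `dΨ` forces `k₀ ≠ 0` at the origin, hence `h = 2 k₁ / (3 k₀)`. Only
derivatives and quotients occur, so the smooth and analytic cases are treated alike. -/

/-! ### The standard cuspidal edge -/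

lemma contDiff_standardCuspidalEdge {n : WithTop ℕ∞} : ContDiff ℝ n standardCuspidalEdge := by
  rw [contDiff_euclidean]
  intro i
  fin_cases i
  · exact contDiff_fst.pow 2
  · exact contDiff_fst.pow 3
  · exact contDiff_snd

lemma standardCuspidalEdge_injective : Function.Injective standardCuspidalEdge := by
  intro p q h
  have h1 : p.1 ^ 3 = q.1 ^ 3 := congrArg (fun x : E3 => x 1) h
  have h2 : p.2 = q.2 := congrArg (fun x : E3 => x 2) h
  exact Prod.ext ((Odd.strictMono_pow (by decide : Odd 3)).injective h1) h2

lemma fderiv_standardCuspidalEdge (p w : ℝ × ℝ) :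
    fderiv ℝ standardCuspidalEdge p w = !₂[2 * p.1 * w.1, 3 * p.1 ^ 2 * w.1, w.2] := by
  have hd : HasFDerivAt standardCuspidalEdge (fderiv ℝ standardCuspidalEdge p) p :=
    (contDiff_standardCuspidalEdge (n := 1)).differentiable one_ne_zero p |>.hasFDerivAt
  have hc : ∀ i, HasFDerivAt (fun x => standardCuspidalEdge x i)
      ((EuclideanSpace.proj i : E3 →L[ℝ] ℝ).comp (fderiv ℝ standardCuspidalEdge p)) p :=
    fun i => (EuclideanSpace.proj i : E3 →L[ℝ] ℝ).hasFDerivAt.comp p hd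
  have h0 := congrArg (fun L : ℝ × ℝ →L[ℝ] ℝ => L w)
    ((hc 0).unique ((hasFDerivAt_fst (𝕜 := ℝ) (p := p)).pow 2))
  have h1 := congrArg (fun L : ℝ × ℝ →L[ℝ] ℝ => L w)
    ((hc 1).unique ((hasFDerivAt_fst (𝕜 := ℝ) (p := p)).pow 3))
  have h2 := congrArg (fun L : ℝ × ℝ →L[ℝ] ℝ => L w)
    ((hc 2).unique (hasFDerivAt_snd (𝕜 := ℝ) (p := p)))
  ext i
  fin_cases i
  · simpa using h0
  · simpa using h1
  · simpa using h2

/-- The tangent vector `u⁻¹ ∂ᵤ (u², u³, v)`, extended smoothly to `u = 0`. -/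
noncomputable def reducedTangent (u : ℝ) : E3 := !₂[2, 3 * u, 0]

lemma contDiff_reducedTangent {n : WithTop ℕ∞} : ContDiff ℝ n reducedTangent := by
  rw [contDiff_euclidean]
  intro i
  fin_cases i
  · exact contDiff_const
  · exact contDiff_const.mul contDiff_id
  · exact contDiff_const

lemma hasDerivAt_standardCuspidalEdge_fst (u v : ℝ) :
    HasDerivAt (fun s => standardCuspidalEdge (s, v)) (u • reducedTangent u) u := by
  have h := ((contDiff_standardCuspidalEdge (n := 1)).differentiable one_ne_zero
    (u, v)).hasFDerivAt.comp_hasDerivAt u ((hasDerivAt_id u).prodMk (hasDerivAt_const u v))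
  have e : fderiv ℝ standardCuspidalEdge (u, v) (1, 0) = u • reducedTangent u := by
    rw [fderiv_standardCuspidalEdge]
    ext i
    fin_cases i <;> simp [reducedTangent] <;> ring
  rw [e] at h
  exact h

lemma hasDerivAt_standardCuspidalEdge_snd (v : ℝ) :
    HasDerivAt (fun s => standardCuspidalEdge (0, s)) !₂[0, 0, 1] v := by
  have h := ((contDiff_standardCuspidalEdge (n := 1)).differentiable one_ne_zero
    (0, v)).hasFDerivAt.comp_hasDerivAt v ((hasDerivAt_const v 0).prodMk (hasDerivAt_id v))
  have e : fderiv ℝ standardCuspidalEdge (0, v) (0, 1) = !₂[0, 0, 1] := by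
    rw [fderiv_standardCuspidalEdge]
    ext i
    fin_cases i <;> simp
  rw [e] at h
  exact h

lemma hasDerivAt_euclidean_apply {c : ℝ → E3} {c' : E3} {t : ℝ} (h : HasDerivAt c c' t)
    (i : Fin 3) : HasDerivAt (fun s => c s i) (c' i) t :=
  (EuclideanSpace.proj i : E3 →L[ℝ] ℝ).hasFDerivAt.comp_hasDerivAt t h

/-! ### Regularity of the induced change of parameters -/

/-- A map that preserves the set of points `(h², h³, z)` transforms the standard cuspidal edge by a
`C^r` change of the parameters. -/
theorem exists_contDiffOn_reparametrization {r : WithTop ℕ∞} (hr : r + 1 ≤ r) (hr0 : r ≠ 0)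
    {O : Set E3} (hO : IsOpen O)
    {Ψ : E3 → E3} (hΨ : ContDiffOn ℝ r Ψ O) {D : Set (ℝ × ℝ)} (hD : IsOpen D)
    (hD0 : (0 : ℝ × ℝ) ∈ D) (hDO : MapsTo standardCuspidalEdge D O)
    (hstd : ∀ p ∈ D, ∃ q : ℝ × ℝ,
      Ψ (standardCuspidalEdge p) = standardCuspidalEdge q ∧ (q.1 = 0 ↔ p.1 = 0))
    (hinj : Function.Injective (fderiv ℝ Ψ (standardCuspidalEdge 0))) :
    ∃ (D' : Set (ℝ × ℝ)) (H : ℝ × ℝ → ℝ × ℝ), IsOpen D' ∧ 0 ∈ D' ∧ D' ⊆ D ∧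
      ContDiffOn ℝ r H D' ∧
      ∀ p ∈ D', Ψ (standardCuspidalEdge p) = standardCuspidalEdge (H p) := by
  have hstdD : ContDiffOn ℝ r standardCuspidalEdge D := contDiff_standardCuspidalEdge.contDiffOn
  have hdiff : ∀ p ∈ D, HasFDerivAt Ψ (fderiv ℝ Ψ (standardCuspidalEdge p))
      (standardCuspidalEdge p) := fun p hp =>
    ((hΨ.contDiffAt (hO.mem_nhds (hDO hp))).differentiableAt hr0).hasFDerivAt
  set k : ℝ × ℝ → E3 := fun p => fderiv ℝ Ψ (standardCuspidalEdge p) (reducedTangent p.1) with hk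
  -- By `r + 1 ≤ r`, differentiating `Ψ` costs no regularity.
  have hkD : ContDiffOn ℝ r k D :=
    ((hΨ.fderiv_of_isOpen hO hr).comp hstdD hDO).clm_apply
      (contDiff_reducedTangent.comp contDiff_fst).contDiffOn
  have hki : ∀ i, ContDiffOn ℝ r (fun p => k p i) D := fun i =>
    (EuclideanSpace.proj i : E3 →L[ℝ] ℝ).contDiff.comp_contDiffOn hkD
  have hGi : ∀ i, ContDiffOn ℝ r (fun p => Ψ (standardCuspidalEdge p) i) D := fun i =>
    (EuclideanSpace.proj i : E3 →L[ℝ] ℝ).contDiff.comp_contDiffOn (hΨ.comp hstdD hDO)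
  -- differentiating `β² = α³` in `u`
  have key : ∀ p ∈ D, ∀ q : ℝ × ℝ, Ψ (standardCuspidalEdge p) = standardCuspidalEdge q →
      q.1 ≠ 0 → p.1 ≠ 0 → 2 * k p 1 = 3 * q.1 * k p 0 := by
    rintro ⟨u, v⟩ hp q hq hq0 hu
    have hder : HasDerivAt (fun s => Ψ (standardCuspidalEdge (s, v))) (u • k (u, v)) u := by
      have := (hdiff _ hp).comp_hasDerivAt u (hasDerivAt_standardCuspidalEdge_fst u v)
      rw [map_smul] at this
      exact this
    have h0 := (hasDerivAt_euclidean_apply hder 0).pow 3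
    have h1 := (hasDerivAt_euclidean_apply hder 1).pow 2
    have hev : (fun s => (Ψ (standardCuspidalEdge (s, v)) 0) ^ 3) =ᶠ[𝓝 u]
        fun s => (Ψ (standardCuspidalEdge (s, v)) 1) ^ 2 := by
      have hc : Tendsto (fun s : ℝ => (s, v)) (𝓝 u) (𝓝 (u, v)) :=
        Continuous.tendsto (by fun_prop) u
      filter_upwards [hc.eventually (hD.mem_nhds hp)] with s hs
      obtain ⟨q', hq', -⟩ := hstd _ hs
      rw [hq']
      simp [standardCuspidalEdge]
      ring
    have := (h0.congr_of_eventuallyEq hev.symm).unique h1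
    rw [hq] at this
    simp [standardCuspidalEdge] at this
    have h3 : (q.1 ^ 3 * u) * (2 * k (u, v) 1 - 3 * q.1 * k (u, v) 0) = 0 := by
      linear_combination -this
    have h4 : q.1 ^ 3 * u ≠ 0 := mul_ne_zero (pow_ne_zero _ hq0) hu
    linarith [(mul_eq_zero.1 h3).resolve_left h4]
  -- the same relation at `u = 0`, by density
  have key0 : ∀ v, ((0 : ℝ), v) ∈ D → k (0, v) 1 = 0 := by
    intro v hv
    have hc : ContinuousAt (fun s : ℝ => (s, v)) 0 := by fun_prop
    have hat : ∀ F : ℝ × ℝ → ℝ, ContDiffOn ℝ r F D → ContinuousAt (fun s => F (s, v)) 0 :=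
      fun F hF => ContinuousAt.comp (f := fun s : ℝ => (s, v))
        (hF.continuousOn.continuousAt (hD.mem_nhds hv)) hc
    -- Continuity of `q.1` in the point is not available. Squaring the relation replaces `q.1 ^ 2`
    -- by the first coordinate of `Ψ`, which is continuous.
    have hcont : ContinuousAt (fun s => 4 * (k (s, v) 1) ^ 2 -
        9 * Ψ (standardCuspidalEdge (s, v)) 0 * (k (s, v) 0) ^ 2) 0 :=
      (continuousAt_const.mul ((hat _ (hki 1)).pow 2)).sub
        ((continuousAt_const.mul (hat _ (hGi 0))).mul ((hat _ (hki 0)).pow 2))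
    have hz : (fun s => 4 * (k (s, v) 1) ^ 2 -
        9 * Ψ (standardCuspidalEdge (s, v)) 0 * (k (s, v) 0) ^ 2) =ᶠ[𝓝[≠] 0] fun _ => 0 := by
      filter_upwards [self_mem_nhdsWithin,
        nhdsWithin_le_nhds (hc.tendsto.eventually (hD.mem_nhds hv))] with s hs hsD
      obtain ⟨q, hq, hq0⟩ := hstd _ hsD
      have h := key _ hsD q hq (fun h => hs (hq0.1 h)) hs
      have h0 : Ψ (standardCuspidalEdge (s, v)) 0 = q.1 ^ 2 := by
        rw [hq]; simp [standardCuspidalEdge]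
      rw [h0]
      linear_combination (2 * k (s, v) 1 + 3 * q.1 * k (s, v) 0) * h
    have hlim := tendsto_nhds_unique (hcont.tendsto.mono_left nhdsWithin_le_nhds)
      ((tendsto_congr' hz).2 tendsto_const_nhds)
    obtain ⟨q, hq, hq0⟩ := hstd _ hv
    have h0 : Ψ (standardCuspidalEdge (0, v)) 0 = 0 := by
      rw [hq]; simp [standardCuspidalEdge, hq0.2 rfl]
    rw [h0] at hlim
    simpa using hlim
  have key' : ∀ p ∈ D, ∀ q : ℝ × ℝ, Ψ (standardCuspidalEdge p) = standardCuspidalEdge q →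
      (q.1 = 0 ↔ p.1 = 0) → 2 * k p 1 = 3 * q.1 * k p 0 := by
    intro p hp q hq hq0
    by_cases hu : p.1 = 0
    · have : p = (0, p.2) := Prod.ext hu rfl
      rw [hq0.2 hu, this, key0 p.2 (this ▸ hp)]
      ring
    · exact key p hp q hq (fun h => hu (hq0.1 h)) hu
  -- The singular line maps into itself, so `L` sends `(0, 0, 1)` to the third axis. If `k 0 0`
  -- vanished, then, as `k 0 1 = 0`, it would also send `(2, 0, 0)` there, contradicting
  -- injectivity.
  have ha0 : k 0 0 ≠ 0 := by
    intro ha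
    set L := fderiv ℝ Ψ (standardCuspidalEdge 0) with hL
    have hb : k 0 1 = 0 := key0 0 hD0
    have hder : HasDerivAt (fun s => Ψ (standardCuspidalEdge (0, s))) (L !₂[0, 0, 1]) 0 :=
      (hdiff 0 hD0).comp_hasDerivAt (0 : ℝ) (hasDerivAt_standardCuspidalEdge_snd 0)
    have hc : Tendsto (fun s : ℝ => ((0 : ℝ), s)) (𝓝 0) (𝓝 0) :=
      Continuous.tendsto (by fun_prop) 0
    have hz : ∀ᶠ s in 𝓝 (0 : ℝ), Ψ (standardCuspidalEdge (0, s)) 0 = 0 ∧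
        Ψ (standardCuspidalEdge (0, s)) 1 = 0 := by
      filter_upwards [hc.eventually (hD.mem_nhds hD0)] with s hs
      obtain ⟨q, hq, hq0⟩ := hstd _ hs
      rw [hq]
      simp [standardCuspidalEdge, hq0.2 rfl]
    have e0 : (L !₂[0, 0, 1]) 0 = 0 :=
      (hasDerivAt_euclidean_apply hder 0).unique
        ((hasDerivAt_const (0 : ℝ) (0 : ℝ)).congr_of_eventuallyEq (hz.mono fun _ h => h.1))
    have e1 : (L !₂[0, 0, 1]) 1 = 0 :=
      (hasDerivAt_euclidean_apply hder 1).unique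
        ((hasDerivAt_const (0 : ℝ) (0 : ℝ)).congr_of_eventuallyEq (hz.mono fun _ h => h.2))
    have hk0 : k 0 = L (reducedTangent 0) := rfl
    rw [hk0] at ha hb
    have hdep : L ((L !₂[0, 0, 1]) 2 • reducedTangent 0 -
        (L (reducedTangent 0)) 2 • !₂[0, 0, 1]) = L 0 := by
      rw [map_sub, map_smul, map_smul, map_zero]
      ext i
      fin_cases i
      · simp [ha, e0]
      · simp [hb, e1]
      · simp [mul_comm]
    have hdep' := hinj hdep
    have h0 := congrArg (fun x : E3 => x 0) hdep'
    simp [reducedTangent] at h0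
    have hzero : (!₂[0, 0, 1] : E3) = 0 := hinj <| by
      rw [map_zero]
      ext i
      fin_cases i
      · exact e0
      · exact e1
      · exact h0
    simpa using congrArg (fun x : E3 => x 2) hzero
  refine ⟨D ∩ (fun p => k p 0) ⁻¹' {0}ᶜ,
    fun p => (2 * k p 1 / (3 * k p 0), Ψ (standardCuspidalEdge p) 2),
    (hki 0).continuousOn.isOpen_inter_preimage hD isOpen_compl_singleton, ⟨hD0, ha0⟩,
    inter_subset_left, ?_, ?_⟩
  · refine ContDiffOn.prodMk (ContDiffOn.div ?_ ?_ ?_) ((hGi 2).mono inter_subset_left)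
    · exact (contDiffOn_const.mul (hki 1)).mono inter_subset_left
    · exact (contDiffOn_const.mul (hki 0)).mono inter_subset_left
    · exact fun p hp => mul_ne_zero three_ne_zero hp.2
  · rintro p ⟨hp, hpa⟩
    obtain ⟨q, hq, hq0⟩ := hstd p hp
    have h := key' p hp q hq hq0
    have hpa : k p 0 ≠ 0 := hpa
    have h1 : 2 * k p 1 / (3 * k p 0) = q.1 := by
      rw [h]; field_simp
    have h2 : Ψ (standardCuspidalEdge p) 2 = q.2 := by rw [hq]; simp [standardCuspidalEdge]
    simp only [h1, h2]
    exact hq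

/-! ### Charts and the singular set -/

lemma fderiv_symm_comp_fderiv {E F : Type*} [NormedAddCommGroup E] [NormedSpace ℝ E]
    [NormedAddCommGroup F] [NormedSpace ℝ F] {r : WithTop ℕ∞} (hr0 : r ≠ 0)
    (e : OpenPartialHomeomorph E F) (h : ContDiffOn ℝ r e e.source)
    (h' : ContDiffOn ℝ r e.symm e.target) {x : E} (hx : x ∈ e.source) :
    (fderiv ℝ e.symm (e x)).comp (fderiv ℝ e x) = ContinuousLinearMap.id ℝ E := by
  have h1 := ((h.contDiffAt (e.open_source.mem_nhds hx)).differentiableAt hr0).hasFDerivAt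
  have h2 := ((h'.contDiffAt (e.open_target.mem_nhds (e.map_source hx))).differentiableAt
    hr0).hasFDerivAt
  refine (h2.comp x h1).unique ((hasFDerivAt_id x).congr_of_eventuallyEq ?_)
  filter_upwards [e.open_source.mem_nhds hx] with y hy using e.left_inv hy

lemma fderiv_injective {E F : Type*} [NormedAddCommGroup E] [NormedSpace ℝ E]
    [NormedAddCommGroup F] [NormedSpace ℝ F] {r : WithTop ℕ∞} (hr0 : r ≠ 0)
    (e : OpenPartialHomeomorph E F) (h : ContDiffOn ℝ r e e.source)
    (h' : ContDiffOn ℝ r e.symm e.target) {x : E} (hx : x ∈ e.source) :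
    Function.Injective (fderiv ℝ e x) :=
  Function.LeftInverse.injective (g := fderiv ℝ e.symm (e x)) fun v =>
    congrArg (fun L : E →L[ℝ] E => L v) (fderiv_symm_comp_fderiv hr0 e h h' hx)

/-- `φ` and `Φ` are `C^r`-diffeomorphisms that bring `F` into the form of the standard cuspidal
edge. -/
structure IsChart (r : WithTop ℕ∞) (U : Set (ℝ × ℝ)) (F : ℝ × ℝ → E3)
    (φ : OpenPartialHomeomorph (ℝ × ℝ) (ℝ × ℝ)) (Φ : OpenPartialHomeomorph E3 E3) : Prop where
  contDiffOn : ContDiffOn ℝ r φ φ.source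
  contDiffOn_symm : ContDiffOn ℝ r φ.symm φ.target
  contDiffOn' : ContDiffOn ℝ r Φ Φ.source
  contDiffOn_symm' : ContDiffOn ℝ r Φ.symm Φ.target
  source_subset : φ.source ⊆ U
  mapsTo : MapsTo F φ.source Φ.source
  eq : ∀ x ∈ φ.source, Φ (F x) = standardCuspidalEdge (φ x)

section Chart

variable {r : WithTop ℕ∞} {U : Set (ℝ × ℝ)} {F : ℝ × ℝ → E3}
  {φ : OpenPartialHomeomorph (ℝ × ℝ) (ℝ × ℝ)} {Φ : OpenPartialHomeomorph E3 E3} {p : ℝ × ℝ}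

lemma IsCuspidalEdgeAt.exists_isChart (h : IsCuspidalEdgeAt r U F p) :
    ∃ φ Φ, IsChart r U F φ Φ ∧ p ∈ φ.source ∧ φ p = 0 ∧ Φ (F p) = 0 := by
  obtain ⟨φ, Φ, h1, h2, h3, h4, hp, hU, hF, hφ, hΦ, h⟩ := h
  refine ⟨φ, Φ, ⟨h1, h2, h3, h4, hU, mapsTo_iff_image_subset.2 hF, fun x hx => ?_⟩, hp, hφ, hΦ⟩
  simpa [φ.left_inv hx] using h _ (φ.map_source hx)

lemma IsChart.restrOpen (h : IsChart r U F φ Φ) (s : Set (ℝ × ℝ)) (hs : IsOpen s) :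
    IsChart r U F (φ.restrOpen s hs) Φ where
  contDiffOn := h.contDiffOn.mono inter_subset_left
  contDiffOn_symm := h.contDiffOn_symm.mono inter_subset_left
  contDiffOn' := h.contDiffOn'
  contDiffOn_symm' := h.contDiffOn_symm'
  source_subset := inter_subset_left.trans h.source_subset
  mapsTo := h.mapsTo.mono_left inter_subset_left
  eq x hx := h.eq x hx.1

lemma IsChart.injOn (h : IsChart r U F φ Φ) : InjOn F φ.source := fun x hx y hy hxy =>
  φ.injOn hx hy <| standardCuspidalEdge_injective <| by rw [← h.eq x hx, ← h.eq y hy, hxy]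

lemma IsChart.fderiv_comp (h : IsChart r U F φ Φ) (hr0 : r ≠ 0) (hU : IsOpen U)
    (hF : ContDiffOn ℝ r F U) (hp : p ∈ φ.source) (w : ℝ × ℝ) :
    fderiv ℝ Φ (F p) (fderiv ℝ F p w) =
      fderiv ℝ standardCuspidalEdge (φ p) (fderiv ℝ φ p w) := by
  have h1 := ((hF.contDiffAt (hU.mem_nhds (h.source_subset hp))).differentiableAt
    hr0).hasFDerivAt
  have h2 := ((h.contDiffOn'.contDiffAt
    (Φ.open_source.mem_nhds (h.mapsTo hp))).differentiableAt hr0).hasFDerivAt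
  have h3 := ((h.contDiffOn.contDiffAt (φ.open_source.mem_nhds hp)).differentiableAt
    hr0).hasFDerivAt
  have h4 := ((contDiff_standardCuspidalEdge (n := 1)).differentiable one_ne_zero
    (φ p)).hasFDerivAt
  have := (h2.comp p h1).unique <| (h4.comp p h3).congr_of_eventuallyEq <| by
    filter_upwards [φ.open_source.mem_nhds hp] with x hx using h.eq x hx
  exact congrArg (fun L : ℝ × ℝ →L[ℝ] E3 => L w) this

/-- At `u = 0` the differential of the standard edge kills `(1, 0)`; the vector `w` is its pullback
under `φ`. -/
lemma IsChart.exists_fderiv_eq_zero (h : IsChart r U F φ Φ) (hr0 : r ≠ 0) (hU : IsOpen U)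
    (hF : ContDiffOn ℝ r F U) (hp : p ∈ φ.source) (hφ : (φ p).1 = 0) :
    ∃ w ≠ 0, fderiv ℝ F p w = 0 := by
  have hinv := fderiv_symm_comp_fderiv hr0 φ.symm h.contDiffOn_symm h.contDiffOn
    (φ.map_source hp)
  rw [φ.symm_symm, φ.left_inv hp] at hinv
  have hw := congrArg (fun L : ℝ × ℝ →L[ℝ] ℝ × ℝ => L (1, 0)) hinv
  simp only [ContinuousLinearMap.comp_apply, ContinuousLinearMap.id_apply] at hw
  set w := fderiv ℝ φ.symm (φ p) (1, 0)
  refine ⟨w, fun h0 => ?_, fderiv_injective hr0 Φ h.contDiffOn' h.contDiffOn_symm' (h.mapsTo hp) ?_⟩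
  · rw [h0, map_zero] at hw
    simpa using congrArg Prod.fst hw
  · rw [h.fderiv_comp hr0 hU hF hp, hw, fderiv_standardCuspidalEdge, map_zero]
    ext i
    fin_cases i <;> simp [hφ]

/-- The standard edge is an immersion off `u = 0`. -/
lemma IsChart.fst_eq_zero (h : IsChart r U F φ Φ) (hr0 : r ≠ 0) (hU : IsOpen U)
    (hF : ContDiffOn ℝ r F U) (hp : p ∈ φ.source) {w : ℝ × ℝ} (hw : w ≠ 0)
    (hFw : fderiv ℝ F p w = 0) : (φ p).1 = 0 := by
  by_contra hu
  have h1 := h.fderiv_comp hr0 hU hF hp w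
  rw [hFw, map_zero, fderiv_standardCuspidalEdge] at h1
  have h10 := congrArg (fun x : E3 => x 0) h1
  have h12 := congrArg (fun x : E3 => x 2) h1
  simp [hu] at h10 h12
  refine hw (fderiv_injective hr0 φ h.contDiffOn h.contDiffOn_symm hp ?_)
  rw [map_zero]
  exact Prod.ext h10 h12.symm

end Chart

lemma StripMap.isOpen_liftDomain (f : StripMap) : IsOpen f.liftDomain :=
  isOpen_univ.prod isOpen_Ioo

/-- A chart need not be centred at `(t, 0)`, but the drop in rank of the differential there, read
off from a centred chart, does not depend on the chart. -/
lemma StripMap.IsCuspidalEdgeAlong.fst_eq_zero {r : WithTop ℕ∞} (hr0 : r ≠ 0) {C : Set E3}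
    {f : StripMap} (hf : f.IsCuspidalEdgeAlong r C)
    {φ : OpenPartialHomeomorph (ℝ × ℝ) (ℝ × ℝ)} {Φ : OpenPartialHomeomorph E3 E3}
    (h : IsChart r f.liftDomain f.lift φ Φ) {t : ℝ} (ht : (t, (0 : ℝ)) ∈ φ.source) :
    (φ (t, 0)).1 = 0 := by
  obtain ⟨φ', Φ', h', hp, hφ', -⟩ := (hf.cuspidal t).exists_isChart
  obtain ⟨w, hw, hFw⟩ := h'.exists_fderiv_eq_zero hr0 f.isOpen_liftDomain hf.contDiffOn hp
    (by rw [hφ']; rfl)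
  exact h.fst_eq_zero hr0 f.isOpen_liftDomain hf.contDiffOn ht hw hFw

/-- Around each point of the core there is a chart in which the core is the singular set. -/
lemma StripMap.IsCuspidalEdgeAlong.exists_isChart {r : WithTop ℕ∞} (hr0 : r ≠ 0) {C : Set E3}
    {f : StripMap} (hf : f.IsCuspidalEdgeAlong r C) (t : ℝ) :
    ∃ φ Φ, IsChart r f.liftDomain f.lift φ Φ ∧ (t, 0) ∈ φ.source ∧ φ (t, 0) = 0 ∧
      Φ (f.lift (t, 0)) = 0 ∧ ∀ x ∈ φ.source, (φ x).1 = 0 ↔ x.2 = 0 := by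
  obtain ⟨φ, Φ, h, hp, hφ, hΦ⟩ := (hf.cuspidal t).exists_isChart
  have hline : ContinuousAt (fun s : ℝ => (s, (0 : ℝ))) t := by fun_prop
  have hsrc : ∀ᶠ s in 𝓝 t, (s, (0 : ℝ)) ∈ φ.source :=
    hline.tendsto.eventually (φ.open_source.mem_nhds hp)
  have hφp := h.contDiffOn.contDiffAt (φ.open_source.mem_nhds hp)
  have hcomp : ContDiffAt ℝ r (fun s : ℝ => φ (s, 0)) t :=
    ContDiffAt.comp (f := fun s : ℝ => (s, (0 : ℝ))) t hφp (contDiffAt_id.prodMk contDiffAt_const)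
  have hw : HasStrictDerivAt (fun s : ℝ => (φ (s, 0)).2) (deriv (fun s : ℝ => (φ (s, 0)).2) t) t :=
    (ContDiffAt.snd hcomp).hasStrictDerivAt hr0
  -- The first coordinate of `φ` vanishes along the core, so a vanishing second derivative component
  -- would give `dφ(1, 0) = 0`.
  have hne : deriv (fun s : ℝ => (φ (s, 0)).2) t ≠ 0 := by
    intro h0
    have hd : HasDerivAt (fun s : ℝ => φ (s, 0)) (fderiv ℝ φ (t, 0) (1, 0)) t :=
      (hφp.differentiableAt hr0).hasFDerivAt.comp_hasDerivAt t
        ((hasDerivAt_id t).prodMk (hasDerivAt_const t (0 : ℝ)))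
    have hd2 := (hasFDerivAt_snd.comp_hasDerivAt t hd).unique hw.hasDerivAt
    have hd1 := (hasFDerivAt_fst.comp_hasDerivAt t hd).unique <| (hasDerivAt_const t (0 : ℝ)).congr_of_eventuallyEq <| by
      filter_upwards [hsrc] with s hs using hf.fst_eq_zero hr0 h hs
    have := fderiv_injective hr0 φ h.contDiffOn h.contDiffOn_symm hp
      (a₁ := (1, 0)) (a₂ := 0) (by rw [map_zero]; exact Prod.ext hd1 (hd2.trans h0))
    simpa using congrArg Prod.fst this
  -- The core is locally mapped onto the axis `u = 0`. As `φ` is injective, nearby points sent to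
  -- that axis lie on the core.
  have himage : (fun s : ℝ => (φ (s, 0)).2) '' {s | (s, (0 : ℝ)) ∈ φ.source} ∈ 𝓝 (φ (t, 0)).2 := by
    rw [← hw.map_nhds_eq hne]
    exact image_mem_map hsrc
  have hcore : ∀ᶠ x in 𝓝 (t, (0 : ℝ)), (φ x).1 = 0 → x.2 = 0 := by
    have hc : Tendsto (fun x => (φ x).2) (𝓝 (t, (0 : ℝ))) (𝓝 (φ (t, 0)).2) :=
      hφp.continuousAt.snd
    filter_upwards [hc.eventually himage, φ.open_source.mem_nhds hp] with x hx hxs hx0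
    obtain ⟨s, hs, hsx⟩ := hx
    have : x = (s, 0) := φ.injOn hxs hs
      (Prod.ext (hx0.trans (hf.fst_eq_zero hr0 h hs).symm) hsx.symm)
    rw [this]
  obtain ⟨s, hs, hso, hps⟩ := eventually_nhds_iff.1 hcore
  refine ⟨φ.restrOpen s hso, Φ, h.restrOpen s hso, ⟨hp, hps⟩, hφ, hΦ, fun x hx => ⟨hs x hx.2, ?_⟩⟩
  intro hx0
  have : x = (x.1, 0) := Prod.ext rfl hx0
  have hx1 : x ∈ φ.source := hx.1
  rw [this] at hx1
  change (φ x).1 = 0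
  rw [this]
  exact hf.fst_eq_zero hr0 h hx1

/-! ### Smooth lifts of a map intertwining two edges -/

lemma isOpenQuotientMap_cover (a : ℝ) : IsOpenQuotientMap (cover a) :=
  QuotientAddGroup.isOpenQuotientMap_mk.prodMap IsOpenQuotientMap.id

/-- A continuous map of strips that intertwines two cuspidal edges and preserves the core circles
has `C^r` lifts near the core. -/
theorem exists_contDiffOn_lift {r : WithTop ℕ∞} (hr : r + 1 ≤ r) (hr0 : r ≠ 0) {C C' : Set E3}
    {f g : StripMap} (hf : f.IsCuspidalEdgeAlong r C) (hg : g.IsCuspidalEdgeAlong r C')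
    {χ : AddCircle f.period × ℝ → AddCircle g.period × ℝ} {t s : ℝ}
    (hχ : ContinuousAt χ (cover f.period (t, 0)))
    (hts : χ (cover f.period (t, 0)) = cover g.period (s, 0))
    (hfg : ∀ᶠ p in 𝓝 (cover f.period (t, 0)), f.toFun p = g.toFun (χ p) ∧
      ((χ p).2 = 0 ↔ p.2 = 0)) :
    ∃ (N : Set (ℝ × ℝ)) (Ψ : ℝ × ℝ → ℝ × ℝ), IsOpen N ∧ (t, 0) ∈ N ∧ ContDiffOn ℝ r Ψ N ∧
      ∀ x ∈ N, χ (cover f.period x) = cover g.period (Ψ x) := by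
  obtain ⟨φ, Φ, hc, hp, hφp, hΦp, hcore⟩ := hf.exists_isChart hr0 t
  obtain ⟨φ', Φ', hc', hp', hφp', hΦp', hcore'⟩ := hg.exists_isChart hr0 s
  have hcov := isOpenQuotientMap_cover f.period
  have hcov' := isOpenQuotientMap_cover g.period
  have hFG : f.lift (t, 0) = g.lift (s, 0) := by
    have := hfg.self_of_nhds.1
    rwa [hts] at this
  have hcontF : ContinuousAt f.lift (t, 0) :=
    hf.contDiffOn.continuousOn.continuousAt (f.isOpen_liftDomain.mem_nhds (hc.source_subset hp))
  have hev : ∀ᶠ x in 𝓝 (t, (0 : ℝ)), x ∈ φ.source ∧ f.lift x ∈ Φ'.source ∧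
      χ (cover f.period x) ∈ cover g.period '' φ'.source ∧
      f.lift x = g.toFun (χ (cover f.period x)) ∧ ((χ (cover f.period x)).2 = 0 ↔ x.2 = 0) := by
    have hcc : Tendsto (cover f.period) (𝓝 (t, 0)) (𝓝 (cover f.period (t, 0))) :=
      hcov.continuous.tendsto _
    have hχ' : Tendsto (fun x => χ (cover f.period x)) (𝓝 (t, 0))
        (𝓝 (χ (cover f.period (t, 0)))) := hχ.tendsto.comp hcc
    filter_upwards [φ.open_source.mem_nhds hp,
      hcontF.eventually (Φ'.open_source.mem_nhds (hFG ▸ hc'.mapsTo hp')),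
      hχ'.eventually ((hcov'.isOpenMap _ φ'.open_source).mem_nhds (hts ▸ mem_image_of_mem _ hp')),
      hcc.eventually hfg] with x h1 h2 h3 h4
    exact ⟨h1, h2, h3, h4.1, h4.2⟩
  obtain ⟨N, hN, hNo, hpN⟩ := eventually_nhds_iff.1 hev
  -- The transition map of the space charts plays the role of `Ψ`.
  have hτ : ContDiffOn ℝ r (Φ' ∘ Φ.symm) (Φ.target ∩ Φ.symm ⁻¹' Φ'.source) :=
    hc'.contDiffOn'.comp (hc.contDiffOn_symm'.mono inter_subset_left) inter_subset_right
  have hΦsymm : ∀ x ∈ φ.source, Φ.symm (standardCuspidalEdge (φ x)) = f.lift x := fun x hx => by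
    rw [← hc.eq x hx, Φ.left_inv (hc.mapsTo hx)]
  have hlift : ∀ x ∈ N, ∃ y ∈ φ'.source, χ (cover f.period x) = cover g.period y ∧
      Φ' (f.lift x) = standardCuspidalEdge (φ' y) ∧ ((φ' y).1 = 0 ↔ (φ x).1 = 0) := by
    intro x hx
    obtain ⟨hxs, -, ⟨y, hy, hxy⟩, heq, hx0⟩ := hN x hx
    refine ⟨y, hy, hxy.symm, ?_, ?_⟩
    · rw [heq, ← hxy]
      exact hc'.eq y hy
    · rw [hcore x hxs, hcore' y hy, ← hx0, ← hxy]
      rfl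
  have hDinv : ∀ q ∈ φ.target ∩ φ.symm ⁻¹' N, ∃ x ∈ N, φ x = q := fun q hq =>
    ⟨φ.symm q, hq.2, φ.right_inv hq.1⟩
  have hstd0 : standardCuspidalEdge 0 = Φ (f.lift (t, 0)) := by rw [hc.eq _ hp, hφp]
  obtain ⟨D', H, hD'o, hD'0, hD'D, hH, hHeq⟩ := exists_contDiffOn_reparametrization hr hr0
    (Φ.symm.continuousOn.isOpen_inter_preimage Φ.open_target Φ'.open_source) hτ
    (φ.symm.continuousOn.isOpen_inter_preimage φ.open_target hNo)
    (by
      rw [← hφp]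
      exact ⟨φ.map_source hp, by rwa [mem_preimage, φ.left_inv hp]⟩)
    (by
      intro q hq
      obtain ⟨x, hx, rfl⟩ := hDinv q hq
      have hxs := (hN x hx).1
      refine ⟨hc.eq x hxs ▸ Φ.map_source (hc.mapsTo hxs), ?_⟩
      rw [mem_preimage, hΦsymm x hxs]
      exact (hN x hx).2.1)
    (by
      intro q hq
      obtain ⟨x, hx, rfl⟩ := hDinv q hq
      obtain ⟨y, -, -, h1, h2⟩ := hlift x hx
      exact ⟨φ' y, by rw [Function.comp_apply, hΦsymm x (hN x hx).1, h1], h2⟩)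
    (by
      have h1 : Φ.symm (standardCuspidalEdge 0) ∈ Φ'.source := by
        rw [hstd0, Φ.left_inv (hc.mapsTo hp), hFG]
        exact hc'.mapsTo hp'
      have h2 : standardCuspidalEdge 0 ∈ Φ.target := hstd0 ▸ Φ.map_source (hc.mapsTo hp)
      rw [fderiv_comp _
        ((hc'.contDiffOn'.contDiffAt (Φ'.open_source.mem_nhds h1)).differentiableAt hr0)
        ((hc.contDiffOn_symm'.contDiffAt (Φ.open_target.mem_nhds h2)).differentiableAt hr0)]
      exact (fderiv_injective hr0 Φ' hc'.contDiffOn' hc'.contDiffOn_symm' h1).comp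
        (fderiv_injective hr0 Φ.symm hc.contDiffOn_symm' hc.contDiffOn' h2))
  -- Injectivity of the standard edge identifies `H ∘ φ` with `χ` read in the target chart.
  have hHy : ∀ x ∈ φ.source ∩ φ ⁻¹' D', ∃ y ∈ φ'.source,
      χ (cover f.period x) = cover g.period y ∧ H (φ x) = φ' y := by
    rintro x ⟨hxs, hxD⟩
    have hxN : x ∈ N := by simpa [φ.left_inv hxs] using (hD'D hxD).2
    obtain ⟨y, hy, h1, h2, -⟩ := hlift x hxN
    refine ⟨y, hy, h1, standardCuspidalEdge_injective ?_⟩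
    rw [← hHeq _ hxD, Function.comp_apply, hΦsymm x hxs, h2]
  refine ⟨φ.source ∩ φ ⁻¹' D', fun x => φ'.symm (H (φ x)),
    φ.continuousOn.isOpen_inter_preimage φ.open_source hD'o, ⟨hp, ?_⟩, ?_, ?_⟩
  · rwa [mem_preimage, hφp]
  · refine hc'.contDiffOn_symm.comp
      (hH.comp (hc.contDiffOn.mono inter_subset_left) inter_subset_right) ?_
    intro x hx
    obtain ⟨y, hy, -, h⟩ := hHy x hx
    change H (φ x) ∈ φ'.target
    rw [h]
    exact φ'.map_source hy
  · intro x hx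
    obtain ⟨y, hy, h1, h⟩ := hHy x hx
    simp only [h, φ'.left_inv hy, h1]

/-! ### Inverses on compact sets and gluing of local lifts -/

/-- Relatively closed subsets of `K` are compact, so their images are compact, hence closed. -/
lemma continuousOn_invFunOn {X Y : Type*} [TopologicalSpace X] [TopologicalSpace Y] [T2Space Y]
    [Nonempty X] {K : Set X} (hK : IsCompact K) {f : X → Y} (hf : ContinuousOn f K)
    (hinj : InjOn f K) : ContinuousOn (Function.invFunOn f K) (f '' K) := by
  rw [continuousOn_iff_isClosed]
  intro t ht
  refine ⟨f '' (K ∩ t), ((hK.inter_right ht).image_of_continuousOn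
    (hf.mono inter_subset_left)).isClosed, ?_⟩
  ext y
  constructor
  · rintro ⟨hy, hyK⟩
    exact ⟨⟨_, ⟨Function.invFunOn_mem hyK, hy⟩, Function.invFunOn_eq hyK⟩, hyK⟩
  · rintro ⟨⟨x, ⟨hxK, hxt⟩, rfl⟩, hyK⟩
    exact ⟨by rwa [mem_preimage, hinj.leftInvOn_invFunOn hxK], hyK⟩

/-- Two injective maps on compact sets that have the same image on open subsets differ by a
homeomorphism of these subsets. -/
lemma exists_openPartialHomeomorph_of_image_eq {X Y Z : Type*} [TopologicalSpace X]
    [TopologicalSpace Y] [TopologicalSpace Z] [T2Space Z] [Nonempty X] [Nonempty Y]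
    {f : X → Z} {g : Y → Z} {K U : Set X} {L V : Set Y} (hK : IsCompact K) (hL : IsCompact L)
    (hf : ContinuousOn f K) (hg : ContinuousOn g L) (hfK : InjOn f K) (hgL : InjOn g L)
    (hU : IsOpen U) (hV : IsOpen V) (hUK : U ⊆ K) (hVL : V ⊆ L) (h : g '' V = f '' U) :
    ∃ e : OpenPartialHomeomorph X Y, e.source = U ∧ e.target = V ∧ ∀ p ∈ U, f p = g (e p) := by
  have h1 : ∀ p ∈ U, ∃ q ∈ V, g q = f p ∧ Function.invFunOn g L (f p) = q := fun p hp => by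
    obtain ⟨q, hq, hqp⟩ := h.symm.subset (mem_image_of_mem f hp)
    exact ⟨q, hq, hqp, by rw [← hqp, hgL.leftInvOn_invFunOn (hVL hq)]⟩
  have h2 : ∀ q ∈ V, ∃ p ∈ U, f p = g q ∧ Function.invFunOn f K (g q) = p := fun q hq => by
    obtain ⟨p, hp, hqp⟩ := h.subset (mem_image_of_mem g hq)
    exact ⟨p, hp, hqp, by rw [← hqp, hfK.leftInvOn_invFunOn (hUK hp)]⟩
  -- The inverses are taken over the compact sets `L` and `K`, where they are continuous, and then
  -- restricted.
  refine ⟨{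
    toFun := fun p => Function.invFunOn g L (f p)
    invFun := fun q => Function.invFunOn f K (g q)
    source := U
    target := V
    map_source' := fun p hp => by
      obtain ⟨q, hq, -, h⟩ := h1 p hp
      rwa [h]
    map_target' := fun q hq => by
      obtain ⟨p, hp, -, h⟩ := h2 q hq
      rwa [h]
    left_inv' := fun p hp => by
      obtain ⟨q, hq, hqp, h⟩ := h1 p hp
      rw [h, hqp, hfK.leftInvOn_invFunOn (hUK hp)]
    right_inv' := fun q hq => by
      obtain ⟨p, hp, hqp, h⟩ := h2 q hq
      rw [h, hqp, hgL.leftInvOn_invFunOn (hVL hq)]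
    open_source := hU
    open_target := hV
    continuousOn_toFun := (continuousOn_invFunOn hL hg hgL).comp (hf.mono hUK) fun p hp => by
      obtain ⟨q, hq, hqp, -⟩ := h1 p hp
      exact ⟨q, hVL hq, hqp⟩
    continuousOn_invFun := (continuousOn_invFunOn hK hf hfK).comp (hg.mono hVL) fun q hq => by
      obtain ⟨p, hp, hqp, -⟩ := h2 q hq
      exact ⟨p, hUK hp, hqp⟩ }, rfl, rfl, fun p hp => ?_⟩
  obtain ⟨q, hq, hqp, h⟩ := h1 p hp
  change f p = g (Function.invFunOn g L (f p))
  rw [h, hqp]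

lemma exists_eq_cover_of_mem_core {a : ℝ} {p : AddCircle a × ℝ} (hp : p ∈ core a) :
    ∃ t : ℝ, p = cover a (t, 0) := by
  obtain ⟨t, ht⟩ := QuotientAddGroup.mk_surjective p.1
  exact ⟨t, Prod.ext ht.symm hp⟩

lemma isCompact_univ_prod {a : ℝ} (ha : 0 < a) {s : Set ℝ} (hs : IsCompact s) :
    IsCompact ((univ : Set (AddCircle a)) ×ˢ s) := by
  have := Fact.mk ha
  exact isCompact_univ.prod hs

lemma core_eq (a : ℝ) : core a = univ ×ˢ {0} := by
  ext p; simp [core]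

/-- A map of strips that has `C^r` lifts near each point of the core is of class `C^r` near the
core. -/
lemma exists_isOpen_contDiffOnStrip {r : WithTop ℕ∞} {a b : ℝ}
    {χ : AddCircle a × ℝ → AddCircle b × ℝ}
    (h : ∀ t : ℝ, ∃ (N : Set (ℝ × ℝ)) (Ψ : ℝ × ℝ → ℝ × ℝ), IsOpen N ∧ (t, 0) ∈ N ∧
      ContDiffOn ℝ r Ψ N ∧ ∀ x ∈ N, χ (cover a x) = cover b (Ψ x)) :
    ∃ W, IsOpen W ∧ core a ⊆ W ∧ ContDiffOnStrip r χ W := by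
  choose N Ψ hN ht hΨ hχ using h
  refine ⟨⋃ t, cover a '' N t,
    isOpen_iUnion fun t => (isOpenQuotientMap_cover a).isOpenMap _ (hN t), ?_, ?_⟩
  · intro p hp
    obtain ⟨t, rfl⟩ := exists_eq_cover_of_mem_core hp
    exact mem_iUnion.2 ⟨t, mem_image_of_mem _ (ht t)⟩
  · intro x hx
    obtain ⟨t, y, hy, hyx⟩ := mem_iUnion.1 hx
    -- `x` and `y` lie over the same point, so `y - x` is a deck translation. It moves the lift
    -- found near `y` to one near `x`.
    have hcov : ∀ z, cover a (z + (y - x)) = cover a z := fun z => by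
      have h1 : (y.1 : AddCircle a) = x.1 := congrArg Prod.fst hyx
      have h2 : y.2 = x.2 := congrArg (fun p : AddCircle a × ℝ => p.2) hyx
      refine Prod.ext ?_ ?_
      · change ((z.1 + (y.1 - x.1) : ℝ) : AddCircle a) = z.1
        rw [AddCircle.coe_add, AddCircle.coe_sub, h1, sub_self, add_zero]
      · change z.2 + (y.2 - x.2) = z.2
        rw [h2, sub_self, add_zero]
    refine ⟨fun z => Ψ t (z + (y - x)), ?_, ?_⟩
    · refine ContDiffAt.comp (g := Ψ t) x ?_ (contDiffAt_id.add contDiffAt_const)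
      simpa using (hΨ t).contDiffAt ((hN t).mem_nhds hy)
    · have hc : Tendsto (fun z : ℝ × ℝ => z + (y - x)) (𝓝 x) (𝓝 y) := by
        have : ContinuousAt (fun z : ℝ × ℝ => z + (y - x)) x := by fun_prop
        simpa [ContinuousAt] using this
      filter_upwards [hc.eventually ((hN t).mem_nhds hy)] with z hz
      rw [← hcov z, hχ t _ hz]

/-! ### Injectivity near the core and composition with isometries -/

namespace StripMap

lemma isOpen_domain (f : StripMap) : IsOpen f.domain :=
  (isOpen_lt continuous_const continuous_snd).inter (isOpen_lt continuous_snd continuous_const)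

lemma core_subset_domain (f : StripMap) : core f.period ⊆ f.domain := fun p hp => by
  have hp : p.2 = 0 := hp
  have := f.eps_pos
  simp [domain, hp, this]

namespace IsCuspidalEdgeAlong

variable {r : WithTop ℕ∞} {C : Set E3} {f : StripMap}

lemma continuousOn (hf : f.IsCuspidalEdgeAlong r C) : ContinuousOn f.toFun f.domain := by
  intro p hp
  obtain ⟨x, rfl⟩ := (isOpenQuotientMap_cover f.period).surjective p
  refine ContinuousAt.continuousWithinAt ?_
  rw [← (isOpenQuotientMap_cover f.period).continuousAt_comp_iff]
  exact hf.contDiffOn.continuousOn.continuousAt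
    (f.isOpen_liftDomain.mem_nhds ⟨mem_univ _, hp⟩)

lemma injOn_core (hf : f.IsCuspidalEdgeAlong r C) : InjOn f.toFun (core f.period) := by
  rintro ⟨p, u⟩ hp ⟨q, v⟩ hq h
  obtain rfl : u = 0 := hp
  obtain rfl : v = 0 := hq
  rw [hf.bijOn.injOn (mem_univ p) (mem_univ q) h]

/-- Charts make `f` locally injective, and it is injective on the compact core; together these give
injectivity on a neighbourhood, which contains a strip by the tube lemma. -/
lemma exists_injOn_strip (hf : f.IsCuspidalEdgeAlong r C) :
    ∃ δ, 0 < δ ∧ δ < f.eps ∧ InjOn f.toFun (univ ×ˢ Icc (-δ) δ) := by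
  have hcore : IsCompact (core f.period) :=
    core_eq f.period ▸ isCompact_univ_prod f.period_pos isCompact_singleton
  obtain ⟨t, hto, hct, ht⟩ := hf.injOn_core.exists_isOpen_superset hcore
    (fun p hp => hf.continuousOn.continuousAt
      (f.isOpen_domain.mem_nhds (f.core_subset_domain hp))) (by
    intro p hp
    obtain ⟨s, rfl⟩ := exists_eq_cover_of_mem_core hp
    obtain ⟨φ, Φ, h, hs, -⟩ := (hf.cuspidal s).exists_isChart
    refine ⟨cover f.period '' φ.source, ((isOpenQuotientMap_cover _).isOpenMap _
      φ.open_source).mem_nhds (mem_image_of_mem _ hs), ?_⟩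
    rintro _ ⟨x, hx, rfl⟩ _ ⟨y, hy, rfl⟩ hxy
    rw [h.injOn hx hy hxy])
  have := Fact.mk f.period_pos
  rw [core_eq] at hct
  obtain ⟨u, v, -, hv, hu, h0, huv⟩ :=
    generalized_tube_lemma isCompact_univ isCompact_singleton hto hct
  obtain ⟨δ, hδ, hδv⟩ := Metric.nhds_basis_closedBall.mem_iff.1
    (hv.mem_nhds (h0 (mem_singleton 0)))
  -- The bound `f.eps / 2` keeps the closed strip inside the open domain.
  refine ⟨min δ (f.eps / 2), lt_min hδ (half_pos f.eps_pos),
    (min_le_right _ _).trans_lt (half_lt_self f.eps_pos), ht.mono ?_⟩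
  rintro p ⟨-, hp1, hp2⟩
  refine huv ⟨hu (mem_univ _), hδv ?_⟩
  rw [Metric.mem_closedBall, Real.dist_0_eq_abs, abs_le]
  exact ⟨(neg_le_neg (min_le_left _ _)).trans hp1, hp2.trans (min_le_left _ _)⟩

/-- An isometry of space maps cuspidal edges to cuspidal edges. -/
lemma comp (hf : f.IsCuspidalEdgeAlong r C) (T : E3 ≃ᵢ E3) :
    (f.comp T).IsCuspidalEdgeAlong r (T '' C) := by
  -- Isometries of Euclidean space are affine (Mazur–Ulam).
  have hsmooth : ∀ S : E3 ≃ᵢ E3, ContDiff ℝ r S := fun S =>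
    (S.toRealAffineIsometryEquiv.toContinuousAffineEquiv : E3 →ᴬ[ℝ] E3).contDiff
  refine ⟨(hsmooth T).comp_contDiffOn hf.contDiffOn,
    T.injective.injOn.bijOn_image.comp hf.bijOn, fun t => ?_⟩
  obtain ⟨φ, Φ, h1, h2, h3, h4, hp, hU, hF, hφ, hΦ, h⟩ := hf.cuspidal t
  have hT : ∀ x, T.symm ((f.comp T).lift x) = f.lift x := fun x => T.symm_apply_apply _
  refine ⟨φ, T.symm.toHomeomorph.toOpenPartialHomeomorph.trans Φ, h1, h2, ?_, ?_, hp, hU, ?_, hφ,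
    ?_, fun x hx => ?_⟩
  · exact h3.comp (hsmooth T.symm).contDiffOn fun x hx => hx.2
  · exact (hsmooth T).comp_contDiffOn (h4.mono inter_subset_left)
  · rintro _ ⟨x, hx, rfl⟩
    refine ⟨mem_univ _, ?_⟩
    change T.symm ((f.comp T).lift x) ∈ Φ.source
    rw [hT]
    exact hF (mem_image_of_mem _ hx)
  · change Φ (T.symm ((f.comp T).lift _)) = 0
    rw [hT, hΦ]
  · change Φ (T.symm ((f.comp T).lift _)) = _
    rw [hT]
    exact h x hx

end IsCuspidalEdgeAlong

end StripMap

/-! ### Right equivalence and equality of images -/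

lemma RightEquivalent.sameImage {r : WithTop ℕ∞} {f g : StripMap} (h : RightEquivalent r g f) :
    SameImage g f := by
  obtain ⟨e, hcf, -, hcg, -, -, -, hcore, hfg⟩ := h
  rintro V₁ V₂ hV₁ hcV₁ - hV₂ hcV₂ -
  have hU : IsOpen (e.source ∩ e ⁻¹' V₁ ∩ V₂) :=
    (e.continuousOn.isOpen_inter_preimage e.open_source hV₁).inter hV₂
  refine ⟨e '' (e.source ∩ e ⁻¹' V₁ ∩ V₂), e.source ∩ e ⁻¹' V₁ ∩ V₂,
    e.isOpen_image_of_subset_source hU fun p hp => hp.1.1, ?_, ?_, hU, ?_, inter_subset_right, ?_⟩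
  · intro q hq
    obtain ⟨p, hp, rfl⟩ := hcore.symm.subset hq
    exact ⟨p, ⟨⟨hcf hp, hcV₁ hq⟩, hcV₂ hp⟩, rfl⟩
  · rintro _ ⟨p, hp, rfl⟩
    exact hp.1.2
  · exact fun p hp => ⟨⟨hcf hp, hcV₁ (hcore.subset (mem_image_of_mem _ hp))⟩, hcV₂ hp⟩
  · rw [image_image]
    exact image_congr fun p hp => (hfg p hp.1.1).symm

lemma SameImage.symm {f g : StripMap} (h : SameImage g f) : SameImage f g := by
  intro V₁ V₂ h1 h2 h3 h4 h5 h6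
  obtain ⟨U₁, U₂, k1, k2, k3, k4, k5, k6, k7⟩ := h V₂ V₁ h4 h5 h6 h1 h2 h3
  exact ⟨U₂, U₁, k4, k5, k6, k1, k2, k3, k7.symm⟩

/-- If `f p` were not on the core curve of `g`, the preimage of `{f p}ᶜ` would be a neighbourhood of
the core of `g` whose image misses `f p`. -/
lemma SameImage.image_core_subset {f g : StripMap} (h : SameImage g f)
    (hg : ContinuousOn g.toFun g.domain) :
    f.toFun '' core f.period ⊆ g.toFun '' core g.period := by
  rintro _ ⟨p, hp, rfl⟩
  by_contra hne
  obtain ⟨U₁, U₂, -, -, hU₁, -, hU₂, -, himage⟩ := h (g.domain ∩ g.toFun ⁻¹' {f.toFun p}ᶜ) f.domain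
    (hg.isOpen_inter_preimage g.isOpen_domain isOpen_compl_singleton)
    (fun q hq => ⟨g.core_subset_domain hq, fun hqp => hne ⟨q, hq, hqp⟩⟩) inter_subset_left
    f.isOpen_domain f.core_subset_domain subset_rfl
  obtain ⟨q, hq, hqp⟩ := himage.symm.subset (mem_image_of_mem f.toFun (hU₂ hp))
  exact (hU₁ hq).2 hqp

/-- Two curves are allowed because `T ∘ g` runs along `T '' C`. -/
theorem SameImage.rightEquivalent {r : WithTop ℕ∞} (hr : r + 1 ≤ r) (hr0 : r ≠ 0) {C C' : Set E3}
    {f g : StripMap} (hf : f.IsCuspidalEdgeAlong r C) (hg : g.IsCuspidalEdgeAlong r C')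
    (h : SameImage g f) : RightEquivalent r g f := by
  have himage : f.toFun '' core f.period = g.toFun '' core g.period :=
    (h.image_core_subset hg.continuousOn).antisymm (h.symm.image_core_subset hf.continuousOn)
  obtain ⟨δ, hδ, hδf, hδinj⟩ := hf.exists_injOn_strip
  obtain ⟨η, hη, hηg, hηinj⟩ := hg.exists_injOn_strip
  have hstrip : ∀ (k : StripMap) (d : ℝ), d < k.eps →
      (univ : Set (AddCircle k.period)) ×ˢ Icc (-d) d ⊆ k.domain := fun k d hd p hp =>
    ⟨(neg_lt_neg hd).trans_le hp.2.1, hp.2.2.trans_lt hd⟩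
  have hcore : ∀ (a d : ℝ), 0 < d → core a ⊆ (univ : Set (AddCircle a)) ×ˢ Ioo (-d) d := by
    intro a d hd p hp
    have hp : p.2 = 0 := hp
    exact ⟨mem_univ _, by simp [hp, hd], by simp [hp, hd]⟩
  have hIoo : ∀ (a d : ℝ), (univ : Set (AddCircle a)) ×ˢ Ioo (-d) d ⊆ univ ×ˢ Icc (-d) d :=
    fun a d => prod_mono_right Ioo_subset_Icc_self
  obtain ⟨U₁, U₂, hU₁, hcU₁, hU₁s, hU₂, hcU₂, hU₂s, hU⟩ := h (univ ×ˢ Ioo (-η) η)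
    (univ ×ˢ Ioo (-δ) δ) (isOpen_univ.prod isOpen_Ioo) (hcore _ _ hη)
    ((hIoo _ _).trans (hstrip g η hηg)) (isOpen_univ.prod isOpen_Ioo) (hcore _ _ hδ)
    ((hIoo _ _).trans (hstrip f δ hδf))
  obtain ⟨e, rfl, rfl, hfg⟩ := exists_openPartialHomeomorph_of_image_eq
    (isCompact_univ_prod f.period_pos isCompact_Icc)
    (isCompact_univ_prod g.period_pos isCompact_Icc)
    (hf.continuousOn.mono (hstrip f δ hδf)) (hg.continuousOn.mono (hstrip g η hηg))
    hδinj hηinj hU₂ hU₁ (hU₂s.trans (hIoo _ _)) (hU₁s.trans (hIoo _ _)) hU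
  have hfg' : ∀ q ∈ e.target, g.toFun q = f.toFun (e.symm q) := fun q hq => by
    rw [hfg _ (e.map_target hq), e.right_inv hq]
  -- The core curves have the same image, and injectivity on the strips leaves no preimage of it off
  -- the cores.
  have hiff : ∀ p ∈ e.source, (e p).2 = 0 ↔ p.2 = 0 := by
    intro p hp
    constructor
    · intro h0
      obtain ⟨q, hq, hqp⟩ := himage.symm.subset (mem_image_of_mem g.toFun (show e p ∈ core _ from h0))
      rw [← hfg p hp] at hqp
      rw [← hδinj (hIoo _ _ (hcore _ _ hδ hq)) (hIoo _ _ (hU₂s hp)) hqp]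
      exact hq
    · intro h0
      obtain ⟨q, hq, hqp⟩ := himage.subset (mem_image_of_mem f.toFun (show p ∈ core _ from h0))
      rw [hfg p hp] at hqp
      rw [← hηinj (hIoo _ _ (hcore _ _ hη hq)) (hIoo _ _ (hU₁s (e.map_source hp))) hqp]
      exact hq
  have hiff' : ∀ q ∈ e.target, (e.symm q).2 = 0 ↔ q.2 = 0 := fun q hq => by
    rw [← hiff _ (e.map_target hq), e.right_inv hq]
  obtain ⟨W, hW, hcW, hWs⟩ : ∃ W, IsOpen W ∧ core f.period ⊆ W ∧ ContDiffOnStrip r e W := by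
    refine exists_isOpen_contDiffOnStrip fun t => ?_
    have ht : cover f.period (t, 0) ∈ e.source := hcU₂ rfl
    obtain ⟨s, hs⟩ := exists_eq_cover_of_mem_core
      (show e (cover f.period (t, 0)) ∈ core g.period from (hiff _ ht).2 rfl)
    refine exists_contDiffOn_lift hr hr0 hf hg (e.continuousAt ht) hs ?_
    filter_upwards [e.open_source.mem_nhds ht] with p hp using ⟨hfg p hp, hiff p hp⟩
  obtain ⟨W', hW', hcW', hWs'⟩ :
      ∃ W, IsOpen W ∧ core g.period ⊆ W ∧ ContDiffOnStrip r e.symm W := by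
    refine exists_isOpen_contDiffOnStrip fun t => ?_
    have ht : cover g.period (t, 0) ∈ e.target := hcU₁ rfl
    obtain ⟨s, hs⟩ := exists_eq_cover_of_mem_core
      (show e.symm (cover g.period (t, 0)) ∈ core f.period from (hiff' _ ht).2 rfl)
    refine exists_contDiffOn_lift hr hr0 hg hf (e.symm.continuousAt ht) hs ?_
    filter_upwards [e.open_target.mem_nhds ht] with q hq using ⟨hfg' q hq, hiff' q hq⟩
  -- The restriction keeps the points where `e` is `C^r` and whose images lie where `e.symm` is
  -- `C^r`.
  have hs : IsOpen (e.source ∩ e ⁻¹' W' ∩ W) :=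
    (e.continuousOn.isOpen_inter_preimage e.open_source hW').inter hW
  have hsrc : core f.period ⊆ e.source ∩ (e.source ∩ e ⁻¹' W' ∩ W) := fun p hp =>
    ⟨hcU₂ hp, ⟨hcU₂ hp, hcW' ((hiff p (hcU₂ hp)).2 hp)⟩, hcW hp⟩
  have htgt : ∀ q ∈ core g.period, e.symm q ∈ core f.period := fun q hq =>
    (hiff' q (hcU₁ hq)).2 hq
  refine ⟨e.restrOpen _ hs, hsrc, ?_, ?_, ?_, ?_, ?_, ?_, ?_⟩
  · exact fun p hp => hstrip f δ hδf (hIoo _ _ (hU₂s hp.1))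
  · exact fun q hq => ⟨hcU₁ hq, (hsrc (htgt q hq)).2⟩
  · exact fun q hq => hstrip g η hηg (hIoo _ _ (hU₁s hq.1))
  · exact fun x hx => hWs x hx.2.2
  · intro x hx
    refine hWs' x ?_
    have := hx.2.1.2
    rwa [mem_preimage, e.right_inv hx.1] at this
  · ext q
    constructor
    · rintro ⟨p, hp, rfl⟩
      exact (hiff p (hcU₂ hp)).2 hp
    · exact fun hq => ⟨e.symm q, htgt q hq, e.right_inv (hcU₁ hq)⟩
  · exact fun p hp => hfg p hp.1

end CuspEdge

theorem proposition1p3 (r : WithTop ℕ∞) (hr : r = ∞ ∨ r = ω)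
    (C : Set CuspEdge.E3) (hC : CuspEdge.IsKnot r C)
    (f g : CuspEdge.StripMap)
    (hf : f.IsCuspidalEdgeAlong r C) (hg : g.IsCuspidalEdgeAlong r C) :
    (CuspEdge.RightEquivalent r g f ↔ CuspEdge.SameImage g f) ∧
    (CuspEdge.Congruent g f →
      ∃ T : CuspEdge.E3 ≃ᵢ CuspEdge.E3, CuspEdge.RightEquivalent r (g.comp T) f) := by
  have hr1 : r + 1 ≤ r := by rcases hr with rfl | rfl <;> exact le_rfl
  have hr0 : r ≠ 0 := by rcases hr with rfl | rfl <;> simp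
  exact ⟨⟨fun h => h.sameImage, fun h => h.rightEquivalent hr1 hr0 hf hg⟩,
    fun ⟨T, hT⟩ => ⟨T, hT.rightEquivalent hr1 hr0 hf (hg.comp T)⟩⟩
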